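/- Let $U=(U_1,\dots,U_m)^T$ have independent components $U_i\sim\mathcal N(0,1)$, let $H\in\mathbb R^{n\times m}$ have rank $k$, and let $H=QCV^T$ be a compact singular value decomposition: $Q\in\mathbb R^{n\times k}$ and $V\in\mathbb R^{m\times k}$ have orthonormal columns and $C=\operatorname{diag}(\sigma_1,\dots,\sigma_k)$, where $\sigma_1,\dots,\sigma_k>0$ are the nonzero singular values of $H$. Put $X=HU$ and $Y=X+E$, where the perturbation $E\in\mathbb R^n$ is drawn from a conditional distribution $p(E\mid U,X)$ (so $E$ may depend on $U$), and consider, for a budget $D$, the problem of minimizing the mutual information $I(U;Y)\in[0,\infty]$ (natural logarithm) over all conditional distributions $p(E\mid U,X)$ with $\mathbb E[\|E\|^2]\le D$. (1) If $0<D\le\sum_{i=1}^k\sigma_i^2$, then there is $\tau>0$ such that $D_i:=\min(\sigma_i^2,\tau)$ satisfies $\sum_{i=1}^k D_i=D$. The minimum is attained and equals $$\frac12\sum_{i=1}^k\log\frac{\sigma_i^2}{D_i}.$$ There is an optimal perturbation of the form $E^*=Q\Lambda$, where $\Lambda\in\mathbb R^k$ is a random vector, jointly distributed with $U$, with independent components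 and law $\mathcal N(0,\operatorname{diag}(D_1,\dots,D_k))$, and such that, for every $i$, $\sigma_iV_i^TU+\Lambda_i$ is independent of $\Lambda_i$, where $V_i$ is the $i$-th column of $V$. (2) If $D\ge\sum_{i=1}^k\sigma_i^2$, then the minimum is $0$, and $E^*=-HU$ is an optimal perturbation. -/

import Mathlib

open MeasureTheory ProbabilityTheory InformationTheory
open scoped ENNReal Matrix

noncomputable section

/-- Mutual information `I(U;Y)` (in nats): the Kullback-Leibler divergence of the joint law of
`(U, Y)` from the product of the marginal laws. It takes the value `∞` when it is infinite. -/
def mutualInfo {Ω α β : Type*} [MeasurableSpace Ω] [MeasurableSpace α] [MeasurableSpace β]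
    (P : Measure Ω) (U : Ω → α) (Y : Ω → β) : ℝ≥0∞ :=
  klDiv (P.map fun ω => (U ω, Y ω)) ((P.map U).prod (P.map Y))

/-- Given the joint law `p` of `(U, X)`, the admissible perturbations with budget `D`: the
conditional laws `κ = p(E | U, X)` (Markov kernels) such that `𝔼‖E‖² ≤ D` under the joint law
`p ⊗ₘ κ` of `((U, X), E)`. -/
def admissible {m n : ℕ} (p : Measure (EuclideanSpace ℝ (Fin m) × EuclideanSpace ℝ (Fin n)))
    (D : ℝ) : Set (Kernel (EuclideanSpace ℝ (Fin m) × EuclideanSpace ℝ (Fin n))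
      (EuclideanSpace ℝ (Fin n))) :=
  {κ | IsMarkovKernel κ ∧ ∫⁻ w, ‖w.2‖ₑ ^ 2 ∂(p ⊗ₘ κ) ≤ ENNReal.ofReal D}

/-- The objective `I(U; X + E)` when `(U, X)` has law `p` and `E` has conditional law `κ`
given `(U, X)`. -/
def attackedInfo {m n : ℕ} (p : Measure (EuclideanSpace ℝ (Fin m) × EuclideanSpace ℝ (Fin n)))
    (κ : Kernel (EuclideanSpace ℝ (Fin m) × EuclideanSpace ℝ (Fin n))
      (EuclideanSpace ℝ (Fin n))) : ℝ≥0∞ :=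
  mutualInfo (p ⊗ₘ κ) (fun w => w.1.1) (fun w => w.1.2 + w.2)

/-- `H = Q diag(σ) Vᵀ` is a (compact) singular value decomposition of `H`: `Q` and `V` have
orthonormal columns, and the `σ i` are the `k = rank H` nonzero singular values of `H`. -/
structure IsCompactSVD {m n k : ℕ} (H : Matrix (Fin n) (Fin m) ℝ) (Q : Matrix (Fin n) (Fin k) ℝ)
    (σ : Fin k → ℝ) (V : Matrix (Fin m) (Fin k) ℝ) : Prop where
  orthonormal_left : Qᵀ * Q = 1
  orthonormal_right : Vᵀ * V = 1
  pos : ∀ i, 0 < σ i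
  eq_mul : H = Q * Matrix.diagonal σ * Vᵀ

/-- The perturbation `E = -HU`, as a conditional law given `(U, X)`. -/
def cancelAttack {m n : ℕ} (H : Matrix (Fin n) (Fin m) ℝ) :
    Kernel (EuclideanSpace ℝ (Fin m) × EuclideanSpace ℝ (Fin n)) (EuclideanSpace ℝ (Fin n)) :=
  Kernel.deterministic (fun p => -(H.toEuclideanLin p.1))
    ((H.toEuclideanLin.continuous_of_finiteDimensional.measurable.comp measurable_fst).neg)

end

/-! ### Divergence: duality bound, densities and products -/

open scoped NNReal

/-! In the coordinates `z i = σ i * (V i)ᵀ U` this is the rate-distortion problem for independent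
Gaussians of variances `v i = σ i ^ 2`, solved by reverse water-filling at level `τ`.

Lower bound. By Donsker-Varadhan duality, a function `F (u, y)` with `∫ exp F(·, y) ≤ 1` under the
law of `U`, for each `y`, satisfies `𝔼 F ≤ I(U; Y)`. The certificate is the sum over `i` of
`rateTest` at `z i` and `w = Qᵀ y`. It penalizes `(z - w)^2` with multiplier `1 / (2 τ)`, and `d =
min v τ` makes its exponential moment at most one (`lintegral_exp_rateTest_le_one`). Since `z - w =
-Qᵀ E` and `𝔼 ‖Qᵀ E‖² ≤ D = ∑ d i`, its expectation is at least the claimed rate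
(`IsCompactSVD.le_integral_sum_rateTest`).

Upper bound. The optimal channel is built backwards: draw independent `W i` and `Λ i` of variances
`v i - d i` and `d i`, put `z = W - Λ`, and complete `z` to a standard Gaussian `U` by an
independent component orthogonal to the columns of `V` (`IsCompactSVD.map_sourceMix`). Then `X + QΛ
= QW`, and the divergence is bounded by that of the pairs `(W i, z i)`, which is explicit
(`klDiv_pi_reverse`). Conditioning this joint law on `(U, X)` gives the attack.

If the budget covers `𝔼 ‖X‖² = ∑ σ i ^ 2`, cancelling `X` leaves a constant observation. -/

lemma mul_sub_exp_le_klFun {x : ℝ} (hx : 0 ≤ x) (y : ℝ) :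
    x * y + 1 - Real.exp y ≤ klFun x := by
  rw [klFun_apply]
  rcases hx.eq_or_lt with rfl | hx
  · simpa using (Real.exp_pos y).le
  -- Fenchel-Young for `x log x + 1 - x`, whose conjugate is `exp y - 1`: the tangent bound `t + 1 ≤
  -- exp t` multiplied by `x`.
  · have h := Real.add_one_le_exp (y - Real.log x)
    rw [Real.exp_sub, Real.exp_log hx, le_div_iff₀ hx] at h
    nlinarith

/-- One half of the Donsker-Varadhan variational formula. -/
lemma ofReal_integral_le_klDiv {α : Type*} [MeasurableSpace α] {μ ν : Measure α}
    [IsProbabilityMeasure μ] [IsProbabilityMeasure ν] {f : α → ℝ} (hf : Measurable f)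
    (hfμ : Integrable f μ) (hfν : ∫⁻ x, ENNReal.ofReal (Real.exp (f x)) ∂ν ≤ 1) :
    ENNReal.ofReal (∫ x, f x ∂μ) ≤ klDiv μ ν := by
  by_cases htop : klDiv μ ν = ∞
  · simp [htop]
  obtain ⟨hac, hllr⟩ := klDiv_ne_top_iff.1 htop
  have hexp : Integrable (fun x => Real.exp (f x)) ν := by
    refine (lintegral_ofReal_ne_top_iff_integrable (by fun_prop)
      (ae_of_all _ fun x => (Real.exp_pos _).le)).1 (ne_top_of_le_ne_top ENNReal.one_ne_top hfν)
  have hexp1 : ∫ x, Real.exp (f x) ∂ν ≤ 1 := by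
    rw [integral_eq_lintegral_of_nonneg_ae (ae_of_all _ fun x => (Real.exp_pos _).le)
      (by fun_prop)]
    exact ENNReal.toReal_le_of_le_ofReal zero_le_one (by simpa using hfν)
  have hkl : Integrable (fun x => klFun (μ.rnDeriv ν x).toReal) ν :=
    (integrable_klFun_rnDeriv_iff hac).2 hllr
  have hmul : Integrable (fun x => (μ.rnDeriv ν x).toReal * f x) ν := by
    simpa using (integrable_rnDeriv_smul_iff hac).2 hfμ
  have hmuleq : ∫ x, (μ.rnDeriv ν x).toReal * f x ∂ν = ∫ x, f x ∂μ := by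
    simpa using integral_rnDeriv_smul (f := f) hac
  rw [← ENNReal.ofReal_toReal htop, toReal_klDiv_eq_integral_klFun hac]
  refine ENNReal.ofReal_le_ofReal ?_
  -- Fenchel-Young is integrated against `ν` with `x` the density of `μ`. The leftover `1 - ∫ exp f`
  -- is nonnegative by hypothesis, so no logarithmic normalization is needed.
  have := integral_mono ((hmul.add (integrable_const (1 : ℝ))).sub hexp) hkl
    (fun x => mul_sub_exp_le_klFun ENNReal.toReal_nonneg (f x))
  rw [integral_sub' (hmul.add (integrable_const (1 : ℝ))) hexp,
    integral_add' hmul (integrable_const (1 : ℝ)), hmuleq] at this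
  simp only [integral_const, probReal_univ, smul_eq_mul, mul_one] at this
  linarith

lemma klDiv_withDensity_exp {α : Type*} [MeasurableSpace α] {μ ν : Measure α}
    [IsProbabilityMeasure μ] [IsProbabilityMeasure ν] {g : α → ℝ} (hg : Measurable g)
    (h : μ = ν.withDensity fun x => ENNReal.ofReal (Real.exp (g x))) (hgμ : Integrable g μ) :
    klDiv μ ν = ENNReal.ofReal (∫ x, g x ∂μ) := by
  have hac : μ ≪ ν := h ▸ withDensity_absolutelyContinuous _ _
  have hllr : llr μ ν =ᵐ[μ] g := by
    have h1 : μ.rnDeriv ν =ᵐ[ν] fun x => ENNReal.ofReal (Real.exp (g x)) := by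
      rw [h]; exact Measure.rnDeriv_withDensity ν (by fun_prop)
    filter_upwards [hac.ae_le h1] with x hx
    simp [llr, hx, ENNReal.toReal_ofReal (Real.exp_pos _).le]
  rw [klDiv_of_ac_of_integrable hac ((integrable_congr hllr).2 hgμ), integral_congr_ae hllr]
  simp

lemma lintegral_pi_prod_eq_prod {ι : Type*} [Fintype ι] {X : ι → Type*}
    [∀ i, MeasurableSpace (X i)] (μ : ∀ i, Measure (X i)) [∀ i, IsProbabilityMeasure (μ i)]
    {f : ∀ i, X i → ℝ≥0∞} (hf : ∀ i, Measurable (f i)) :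
    ∫⁻ x, ∏ i, f i (x i) ∂(Measure.pi μ) = ∏ i, ∫⁻ x, f i x ∂(μ i) := by
  have hind : iIndepFun (fun i (x : ∀ i, X i) => f i (x i)) (Measure.pi μ) :=
    iIndepFun_pi fun i => (hf i).aemeasurable
  rw [lintegral_prod_eq_prod_lintegral_of_indepFun Finset.univ _ hind
    fun i => (hf i).comp (measurable_pi_apply i)]
  refine Finset.prod_congr rfl fun i _ => ?_
  rw [← (measurePreserving_eval μ i).lintegral_comp (hf i)]

lemma pi_withDensity {ι : Type*} [Fintype ι] {X : ι → Type*}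
    [∀ i, MeasurableSpace (X i)] (μ ν : ∀ i, Measure (X i)) [∀ i, IsProbabilityMeasure (μ i)]
    [∀ i, IsProbabilityMeasure (ν i)] {f : ∀ i, X i → ℝ≥0∞} (hf : ∀ i, Measurable (f i))
    (h : ∀ i, μ i = (ν i).withDensity (f i)) :
    Measure.pi μ = (Measure.pi ν).withDensity fun x => ∏ i, f i (x i) := by
  refine Measure.pi_eq fun s hs => ?_
  rw [withDensity_apply _ (.univ_pi hs), ← lintegral_indicator (.univ_pi hs)]
  have : ∀ x : ∀ i, X i, (Set.univ.pi s).indicator (fun x => ∏ i, f i (x i)) x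
      = ∏ i, (s i).indicator (f i) (x i) := by
    intro x
    by_cases hx : x ∈ Set.univ.pi s
    · rw [Set.indicator_of_mem hx]
      exact Finset.prod_congr rfl fun i _ => (Set.indicator_of_mem (hx i trivial) _).symm
    · rw [Set.indicator_of_notMem hx]
      simp only [Set.mem_pi, Set.mem_univ, true_imp_iff, not_forall] at hx
      obtain ⟨i, hi⟩ := hx
      exact (Finset.prod_eq_zero (Finset.mem_univ i) (Set.indicator_of_notMem hi _)).symm
  simp_rw [this]
  rw [lintegral_pi_prod_eq_prod ν fun i => (hf i).indicator (hs i)]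
  refine Finset.prod_congr rfl fun i _ => ?_
  rw [lintegral_indicator (hs i), h i, withDensity_apply _ (hs i)]

/-! ### Scalar Gaussians: likelihood ratios and the test function -/

/-- Log-likelihood ratio of `𝒩(w, d)` with respect to `𝒩(0, v)`. -/
noncomputable def gaussianLlr (v d w z : ℝ) : ℝ :=
  1 / 2 * Real.log (v / d) + z ^ 2 / (2 * v) - (z - w) ^ 2 / (2 * d)

lemma gaussianReal_eq_withDensity_gaussianLlr (w : ℝ) {v d : ℝ≥0} (hv : v ≠ 0) (hd : d ≠ 0) :
    gaussianReal w d = (gaussianReal 0 v).withDensity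
      fun z => ENNReal.ofReal (Real.exp (gaussianLlr v d w z)) := by
  have hv' : (0 : ℝ) < v := NNReal.coe_pos.2 (pos_iff_ne_zero.2 hv)
  have hd' : (0 : ℝ) < d := NNReal.coe_pos.2 (pos_iff_ne_zero.2 hd)
  rw [gaussianReal_of_var_ne_zero _ hv, gaussianReal_of_var_ne_zero _ hd,
    ← withDensity_mul _ (measurable_gaussianPDF _ _) (by unfold gaussianLlr; fun_prop)]
  congr 1
  ext z
  simp only [Pi.mul_apply, gaussianPDF, gaussianPDFReal]
  rw [← ENNReal.ofReal_mul (by positivity)]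
  congr 1
  have h1 : Real.exp (1 / 2 * Real.log (v / d)) = √v / √d := by
    rw [mul_comm, Real.exp_mul, Real.exp_log (by positivity), ← Real.sqrt_eq_rpow,
      Real.sqrt_div hv'.le]
  have h2 : gaussianLlr v d w z = 1 / 2 * Real.log (v / d) + (z ^ 2 / (2 * v)
      + (-(z - w) ^ 2 / (2 * d))) := by unfold gaussianLlr; ring
  rw [h2, Real.exp_add, Real.exp_add, h1, show -(z - 0) ^ 2 / (2 * (v : ℝ)) = -(z ^ 2 / (2 * v)) by
    ring, Real.exp_neg, Real.sqrt_mul (by positivity) (v : ℝ),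
    Real.sqrt_mul (by positivity) (d : ℝ)]
  have : √(v : ℝ) ≠ 0 := by positivity
  have : √(d : ℝ) ≠ 0 := by positivity
  have : √(2 * Real.pi) ≠ 0 := by positivity
  field_simp

/-- Given the first coordinate `w`, the second has law `𝒩(w, d)`, so only its density relative to
`𝒩(0, v)` enters. The law of `w` is never differentiated, hence `a = 0` is allowed; it occurs when
`σ i ^ 2 ≤ τ`. -/
lemma map_prod_sub_gaussianReal (a : ℝ≥0) {v d : ℝ≥0} (hv : v ≠ 0) (hd : d ≠ 0) :
    ((gaussianReal 0 a).prod (gaussianReal 0 d)).map (fun c => (c.1, c.1 - c.2)) =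
      ((gaussianReal 0 a).prod (gaussianReal 0 v)).withDensity
        fun c => ENNReal.ofReal (Real.exp (gaussianLlr v d c.1 c.2)) := by
  have hm : Measurable fun c : ℝ × ℝ => ENNReal.ofReal (Real.exp (gaussianLlr v d c.1 c.2)) := by
    unfold gaussianLlr; fun_prop
  ext s hs
  rw [Measure.map_apply (by fun_prop) hs, Measure.prod_apply (by measurability),
    withDensity_apply _ hs, ← lintegral_indicator hs, lintegral_prod _ (by fun_prop)]
  refine lintegral_congr fun w => ?_
  have hsw : MeasurableSet (Prod.mk w ⁻¹' s) := measurable_prodMk_left hs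
  have h1 : gaussianReal 0 d (Prod.mk w ⁻¹' ((fun c : ℝ × ℝ => (c.1, c.1 - c.2)) ⁻¹' s))
      = gaussianReal w d (Prod.mk w ⁻¹' s) := by
    rw [show gaussianReal w d = (gaussianReal 0 d).map (w - ·) by
      rw [gaussianReal_map_const_sub, sub_zero], Measure.map_apply (by fun_prop) hsw]
    rfl
  rw [h1, gaussianReal_eq_withDensity_gaussianLlr w hv hd, withDensity_apply _ hsw,
    ← lintegral_indicator hsw]
  rfl

lemma map_sub_gaussianReal (a d : ℝ≥0) :
    ((gaussianReal 0 a).prod (gaussianReal 0 d)).map (fun c => c.1 - c.2) =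
      gaussianReal 0 (a + d) := by
  have h : (fun c : ℝ × ℝ => c.1 - c.2) = (fun c => c.1 + c.2) ∘ (Prod.map id fun x => -x) := by
    ext c; simp [sub_eq_add_neg]
  rw [h, ← Measure.map_map (by fun_prop) (by fun_prop),
    ← Measure.map_prod_map _ _ (by fun_prop) (by fun_prop), gaussianReal_map_neg, Measure.map_id,
    neg_zero]
  have := gaussianReal_conv_gaussianReal (m₁ := 0) (m₂ := 0) (v₁ := a) (v₂ := d)
  simpa [Measure.conv] using this

/-- The test function certifying the rate-distortion bound of a Gaussian source of variance `v`
at slope `τ`. -/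
noncomputable def rateTest (v d τ w z : ℝ) : ℝ :=
  1 / 2 * Real.log (v / d) + d / (2 * v * τ) * z ^ 2 - (z - w) ^ 2 / (2 * τ)

/-- Reweighting by the quadratic part turns `𝒩(0, v)` into `𝒩(0, d)`; what remains is a Gaussian
moment generating function at `w / τ`. -/
lemma lintegral_exp_rateTest_le_one (w : ℝ) {v τ d : ℝ≥0} (hv : v ≠ 0) (hτ : τ ≠ 0)
    (hd : d = min v τ) :
    ∫⁻ z, ENNReal.ofReal (Real.exp (rateTest v d τ w z)) ∂(gaussianReal 0 v) ≤ 1 := by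
  have hd0 : d ≠ 0 := by rcases min_choice v τ with h | h <;> rw [hd, h] <;> assumption
  have hv' : (0 : ℝ) < v := NNReal.coe_pos.2 (pos_iff_ne_zero.2 hv)
  have hd' : (0 : ℝ) < d := NNReal.coe_pos.2 (pos_iff_ne_zero.2 hd0)
  have hτ' : (0 : ℝ) < τ := NNReal.coe_pos.2 (pos_iff_ne_zero.2 hτ)
  have hdτ : (d : ℝ) ≤ τ := by exact_mod_cast hd ▸ min_le_right v τ
  have hdec : ∀ z, rateTest v d τ w z
      = gaussianLlr v d 0 z + (-(w ^ 2 / (2 * τ)) + w / τ * z) := by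
    intro z
    -- This is exactly the equality of the `z ^ 2` coefficients on both sides, and it holds on
    -- either branch of the minimum.
    have hroot : ((d : ℝ) - v) * (d - τ) = 0 := by
      rcases min_choice v τ with h | h <;> rw [hd, h] <;> ring
    unfold rateTest gaussianLlr
    field_simp
    linear_combination z ^ 2 * hroot
  calc ∫⁻ z, ENNReal.ofReal (Real.exp (rateTest v d τ w z)) ∂(gaussianReal 0 v)
      = ∫⁻ z, ENNReal.ofReal (Real.exp (-(w ^ 2 / (2 * τ)) + w / τ * z)) ∂(gaussianReal 0 d) := by
        rw [gaussianReal_eq_withDensity_gaussianLlr 0 hv hd0, lintegral_withDensity_eq_lintegral_mul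
          _ (by unfold gaussianLlr; fun_prop) (by fun_prop)]
        refine lintegral_congr fun z => ?_
        rw [hdec, Real.exp_add, ENNReal.ofReal_mul (Real.exp_pos _).le]
        rfl
    _ = ENNReal.ofReal (∫ z, Real.exp (-(w ^ 2 / (2 * τ))) * Real.exp (w / τ * z)
          ∂(gaussianReal 0 d)) := by
        rw [ofReal_integral_eq_lintegral_ofReal
          ((integrable_exp_mul_gaussianReal _).const_mul _) (ae_of_all _ fun _ => by positivity)]
        simp_rw [Real.exp_add]
    _ ≤ 1 := by
        rw [integral_const_mul]
        have h := congrFun (mgf_fun_id_gaussianReal (μ := 0) (v := d)) (w / τ)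
        simp only [mgf] at h
        rw [h, ← Real.exp_add, ENNReal.ofReal_le_one, Real.exp_le_one_iff]
        -- Because `d ≤ τ`, the exponent of the moment generating function is absorbed by `-w ^ 2 /
        -- (2 τ)`.
        have : (d : ℝ) * (w / τ) ^ 2 / 2 ≤ τ * (w / τ) ^ 2 / 2 := by gcongr
        have h2 : (τ : ℝ) * (w / τ) ^ 2 / 2 = w ^ 2 / (2 * τ) := by field_simp
        linarith

lemma integrable_sq_gaussianReal (v : ℝ≥0) : Integrable (fun x => x ^ 2) (gaussianReal 0 v) :=
  (memLp_id_gaussianReal' 2 (by simp)).integrable_sq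

lemma integral_sq_gaussianReal (v : ℝ≥0) : ∫ x, x ^ 2 ∂(gaussianReal 0 v) = v := by
  have h := variance_fun_id_gaussianReal (μ := 0) (v := v)
  rw [variance_eq_integral (by fun_prop)] at h
  simpa using h

/-! ### Singular coordinates of the Gaussian source -/

section Coordinates

variable {m n k : ℕ}

lemma ofLp_toEuclideanLin_eq_mulVec (A : Matrix (Fin n) (Fin m) ℝ)
    (x : EuclideanSpace ℝ (Fin m)) : (A.toEuclideanLin x).ofLp = A *ᵥ x.ofLp := rfl

lemma norm_sq_eq_dotProduct (x : EuclideanSpace ℝ (Fin n)) : ‖x‖ ^ 2 = x.ofLp ⬝ᵥ x.ofLp := by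
  rw [EuclideanSpace.real_norm_sq_eq]
  simp [dotProduct, sq]

lemma mulVec_dotProduct_mulVec_of_orthonormal {Q : Matrix (Fin n) (Fin k) ℝ} (hQ : Qᵀ * Q = 1)
    (a b : Fin k → ℝ) : (Q *ᵥ a) ⬝ᵥ (Q *ᵥ b) = a ⬝ᵥ b := by
  rw [Matrix.dotProduct_mulVec, Matrix.vecMul_mulVec, ← Matrix.dotProduct_mulVec, hQ,
    Matrix.one_mulVec]

lemma norm_toEuclideanLin_of_orthonormal {Q : Matrix (Fin n) (Fin k) ℝ} (hQ : Qᵀ * Q = 1)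
    (x : EuclideanSpace ℝ (Fin k)) : ‖Q.toEuclideanLin x‖ = ‖x‖ := by
  have : ‖Q.toEuclideanLin x‖ ^ 2 = ‖x‖ ^ 2 := by
    rw [norm_sq_eq_dotProduct, norm_sq_eq_dotProduct, ofLp_toEuclideanLin_eq_mulVec,
      mulVec_dotProduct_mulVec_of_orthonormal hQ]
  exact (sq_eq_sq₀ (norm_nonneg _) (norm_nonneg _)).1 this

/-- Pythagoras for the orthogonal projection `Q Qᵀ`. For `Q` it shows that perturbing outside the
range of `H` only wastes budget; for `V` it splits the source. -/
lemma norm_sq_residual_add_norm_sq_coord {Q : Matrix (Fin n) (Fin k) ℝ} (hQ : Qᵀ * Q = 1)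
    (e : EuclideanSpace ℝ (Fin n)) :
    ‖(1 - Q * Qᵀ).toEuclideanLin e‖ ^ 2 + ‖Qᵀ.toEuclideanLin e‖ ^ 2 = ‖e‖ ^ 2 := by
  simp only [norm_sq_eq_dotProduct, ofLp_toEuclideanLin_eq_mulVec, Matrix.sub_mulVec,
    Matrix.one_mulVec, ← Matrix.mulVec_mulVec]
  have h1 : e.ofLp ⬝ᵥ (Q *ᵥ (Qᵀ *ᵥ e.ofLp)) = (Qᵀ *ᵥ e.ofLp) ⬝ᵥ (Qᵀ *ᵥ e.ofLp) := by
    rw [Matrix.dotProduct_mulVec, ← Matrix.mulVec_transpose]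
  have h2 := mulVec_dotProduct_mulVec_of_orthonormal hQ (Qᵀ *ᵥ e.ofLp) (Qᵀ *ᵥ e.ofLp)
  rw [sub_dotProduct, dotProduct_sub, dotProduct_sub, h2, dotProduct_comm (Q *ᵥ _) e.ofLp, h1]
  ring

lemma norm_transpose_toEuclideanLin_le {Q : Matrix (Fin n) (Fin k) ℝ} (hQ : Qᵀ * Q = 1)
    (e : EuclideanSpace ℝ (Fin n)) : ‖Qᵀ.toEuclideanLin e‖ ≤ ‖e‖ := by
  have := norm_sq_residual_add_norm_sq_coord hQ e
  exact (sq_le_sq₀ (norm_nonneg _) (norm_nonneg _)).1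
    (by nlinarith [sq_nonneg ‖(1 - Q * Qᵀ).toEuclideanLin e‖])

/-- The coordinates `σ i * (V i)ᵀ u` of a source vector `u`. -/
noncomputable def sourceCoord (σ : Fin k → ℝ) (V : Matrix (Fin m) (Fin k) ℝ)
    (u : EuclideanSpace ℝ (Fin m)) (i : Fin k) : ℝ :=
  σ i * ∑ j, V j i * u j

@[fun_prop]
lemma measurable_sourceCoord (σ : Fin k → ℝ) (V : Matrix (Fin m) (Fin k) ℝ) :
    Measurable (sourceCoord σ V) := by
  unfold sourceCoord; fun_prop

@[fun_prop]
lemma measurable_toEuclideanLin (A : Matrix (Fin n) (Fin m) ℝ) :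
    Measurable A.toEuclideanLin :=
  A.toEuclideanLin.continuous_of_finiteDimensional.measurable

/-- A source vector with prescribed coordinates `z`, and the component of `g` orthogonal to the
columns of `V`. -/
noncomputable def sourceMix (σ : Fin k → ℝ) (V : Matrix (Fin m) (Fin k) ℝ) (z : Fin k → ℝ)
    (g : EuclideanSpace ℝ (Fin m)) : EuclideanSpace ℝ (Fin m) :=
  (V * Matrix.diagonal fun i => (σ i)⁻¹).toEuclideanLin (WithLp.toLp 2 z) +
    (1 - V * Vᵀ).toEuclideanLin g

@[fun_prop]
lemma measurable_sourceMix (σ : Fin k → ℝ) (V : Matrix (Fin m) (Fin k) ℝ) :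
    Measurable fun c : (Fin k → ℝ) × EuclideanSpace ℝ (Fin m) => sourceMix σ V c.1 c.2 := by
  unfold sourceMix; fun_prop

lemma sourceCoord_eq_mulVec (σ : Fin k → ℝ) (V : Matrix (Fin m) (Fin k) ℝ)
    (u : EuclideanSpace ℝ (Fin m)) :
    sourceCoord σ V u = Matrix.diagonal σ *ᵥ (Vᵀ *ᵥ u.ofLp) := by
  ext i
  rw [Matrix.mulVec_diagonal]
  rfl

variable {H : Matrix (Fin n) (Fin m) ℝ} {Q : Matrix (Fin n) (Fin k) ℝ} {σ : Fin k → ℝ}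
  {V : Matrix (Fin m) (Fin k) ℝ}

lemma IsCompactSVD.sourceCoord_sourceMix (hH : IsCompactSVD H Q σ V) (z : Fin k → ℝ)
    (g : EuclideanSpace ℝ (Fin m)) : sourceCoord σ V (sourceMix σ V z g) = z := by
  rw [sourceCoord_eq_mulVec]
  have h1 : Vᵀ * (1 - V * Vᵀ) = 0 := by
    rw [Matrix.mul_sub, ← Matrix.mul_assoc, hH.orthonormal_right, Matrix.mul_one, Matrix.one_mul,
      sub_self]
  have h2 : Vᵀ * (V * Matrix.diagonal fun i => (σ i)⁻¹) = Matrix.diagonal fun i => (σ i)⁻¹ := by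
    rw [← Matrix.mul_assoc, hH.orthonormal_right, Matrix.one_mul]
  simp only [sourceMix, WithLp.ofLp_add, ofLp_toEuclideanLin_eq_mulVec, Matrix.mulVec_add,
    Matrix.mulVec_mulVec]
  rw [h1, h2, Matrix.diagonal_mul_diagonal]
  simp [mul_inv_cancel₀ (hH.pos _).ne']

lemma IsCompactSVD.toEuclideanLin_eq (hH : IsCompactSVD H Q σ V) (u : EuclideanSpace ℝ (Fin m)) :
    H.toEuclideanLin u = Q.toEuclideanLin (WithLp.toLp 2 (sourceCoord σ V u)) := by
  apply WithLp.ofLp_injective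
  rw [sourceCoord_eq_mulVec, ofLp_toEuclideanLin_eq_mulVec, ofLp_toEuclideanLin_eq_mulVec,
    hH.eq_mul, Matrix.mulVec_mulVec, Matrix.mulVec_mulVec, Matrix.mul_assoc]

lemma IsCompactSVD.transpose_toEuclideanLin_left (hH : IsCompactSVD H Q σ V)
    (x : EuclideanSpace ℝ (Fin k)) : Qᵀ.toEuclideanLin (Q.toEuclideanLin x) = x := by
  apply WithLp.ofLp_injective
  rw [ofLp_toEuclideanLin_eq_mulVec, ofLp_toEuclideanLin_eq_mulVec, Matrix.mulVec_mulVec,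
    hH.orthonormal_left, Matrix.one_mulVec]

lemma inner_toEuclideanLin (A : Matrix (Fin m) (Fin n) ℝ) (x : EuclideanSpace ℝ (Fin n))
    (y : EuclideanSpace ℝ (Fin m)) :
    inner ℝ (A.toEuclideanLin x) y = inner ℝ x (Aᵀ.toEuclideanLin y) := by
  rw [← Matrix.conjTranspose_eq_transpose_of_trivial,
    Matrix.toEuclideanLin_conjTranspose_eq_adjoint,
    LinearMap.adjoint_inner_right]

lemma charFun_map_toEuclideanLin (A : Matrix (Fin m) (Fin n) ℝ)
    (μ : Measure (EuclideanSpace ℝ (Fin n))) (t : EuclideanSpace ℝ (Fin m)) :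
    charFun (μ.map A.toEuclideanLin) t = charFun μ (Aᵀ.toEuclideanLin t) := by
  rw [charFun_apply, charFun_apply, integral_map (by fun_prop)
    (Measurable.aestronglyMeasurable (by fun_prop))]
  simp_rw [inner_toEuclideanLin]

/-- Standard Gaussian vectors are obtained by mixing independent Gaussian coordinates with an
independent standard Gaussian vector. -/
lemma IsCompactSVD.map_sourceMix (hH : IsCompactSVD H Q σ V) {v : Fin k → ℝ≥0}
    (hv : ∀ i, (v i : ℝ) = σ i ^ 2) :
    ((Measure.pi fun i => gaussianReal 0 (v i)).prod (stdGaussian (EuclideanSpace ℝ (Fin m)))).map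
      (fun c => sourceMix σ V c.1 c.2) = stdGaussian (EuclideanSpace ℝ (Fin m)) := by
  set A := V * Matrix.diagonal fun i => (σ i)⁻¹
  have hconv : ((Measure.pi fun i => gaussianReal 0 (v i)).prod
      (stdGaussian (EuclideanSpace ℝ (Fin m)))).map (fun c => sourceMix σ V c.1 c.2) =
      (((Measure.pi fun i => gaussianReal 0 (v i)).map (WithLp.toLp 2)).map A.toEuclideanLin) ∗
        (stdGaussian (EuclideanSpace ℝ (Fin m))).map (1 - V * Vᵀ).toEuclideanLin := by
    rw [Measure.map_map (by fun_prop) (by fun_prop), Measure.conv,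
      Measure.map_prod_map _ _ (by fun_prop) (by fun_prop),
      Measure.map_map (by fun_prop) (by fun_prop)]
    rfl
  have hsymm : (1 - V * Vᵀ)ᵀ = 1 - V * Vᵀ := by
    simp [Matrix.transpose_sub, Matrix.transpose_mul]
  have := fun i => (hH.pos i).ne'
  -- The factor `(σ i)⁻¹` normalizes each variance, so the two parts contribute `-‖Vᵀ t‖² / 2` and
  -- `-‖(1 - V Vᵀ) t‖² / 2` to the exponent; by Pythagoras these add up to `-‖t‖² / 2`.
  refine Measure.ext_of_charFun (funext fun t => ?_)
  rw [hconv, charFun_conv, charFun_map_toEuclideanLin, charFun_map_toEuclideanLin, charFun_pi,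
    charFun_stdGaussian, charFun_stdGaussian, hsymm,
    ← Complex.ofReal_pow, ← Complex.ofReal_pow,
    ← norm_sq_residual_add_norm_sq_coord hH.orthonormal_right t]
  have hc : ∀ i, (Aᵀ.toEuclideanLin t) i = (σ i)⁻¹ * (Vᵀ.toEuclideanLin t) i := by
    intro i
    simp only [A, Matrix.transpose_mul, Matrix.diagonal_transpose, ofLp_toEuclideanLin_eq_mulVec,
      ← Matrix.mulVec_mulVec, Matrix.mulVec_diagonal]
  simp_rw [charFun_gaussianReal, hc]
  rw [← Complex.exp_sum, ← Complex.exp_add]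
  congr 1
  rw [EuclideanSpace.real_norm_sq_eq (Vᵀ.toEuclideanLin t)]
  push_cast
  have hi : ∀ i, ((σ i : ℂ)⁻¹ * (Vᵀ.toEuclideanLin t i : ℂ)) * 0 * Complex.I -
      (v i : ℂ) * ((σ i : ℂ)⁻¹ * (Vᵀ.toEuclideanLin t i : ℂ)) ^ 2 / 2
      = - (Vᵀ.toEuclideanLin t i : ℂ) ^ 2 / 2 := by
    intro i
    have h1 : (v i : ℂ) = (σ i : ℂ) ^ 2 := by exact_mod_cast congrArg ((↑) : ℝ → ℂ) (hv i)
    have h2 : (σ i : ℂ) ≠ 0 := by exact_mod_cast this i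
    rw [h1]; field_simp; ring
  simp_rw [hi]
  rw [← Finset.sum_div, Finset.sum_neg_distrib]
  ring

lemma IsCompactSVD.map_sourceCoord (hH : IsCompactSVD H Q σ V) {v : Fin k → ℝ≥0}
    (hv : ∀ i, (v i : ℝ) = σ i ^ 2) :
    (stdGaussian (EuclideanSpace ℝ (Fin m))).map (sourceCoord σ V) =
      Measure.pi fun i => gaussianReal 0 (v i) := by
  rw [← hH.map_sourceMix hv, Measure.map_map (by fun_prop) (by fun_prop)]
  have : sourceCoord σ V ∘ (fun c : (Fin k → ℝ) × EuclideanSpace ℝ (Fin m) =>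
      sourceMix σ V c.1 c.2) = Prod.fst := by
    ext1 c; exact hH.sourceCoord_sourceMix _ _
  rw [this, Measure.map_fst_prod]
  simp

lemma map_eq_stdGaussian {Ω : Type*} [MeasurableSpace Ω] {P : Measure Ω} [IsProbabilityMeasure P]
    {U : Ω → EuclideanSpace ℝ (Fin m)}
    (hU_law : ∀ i, HasLaw (fun ω => U ω i) (gaussianReal 0 1) P)
    (hU_indep : iIndepFun (fun i ω => U ω i) P) :
    AEMeasurable U P ∧ P.map U = stdGaussian (EuclideanSpace ℝ (Fin m)) := by
  have hpi : AEMeasurable (fun ω i => U ω i) P :=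
    aemeasurable_pi_lambda _ fun i => (hU_law i).aemeasurable
  have hU : U = WithLp.toLp 2 ∘ fun ω i => U ω i := rfl
  refine ⟨hU ▸ (by fun_prop : Measurable (WithLp.toLp 2)).comp_aemeasurable hpi, ?_⟩
  rw [← map_pi_eq_stdGaussian, hU, ← AEMeasurable.map_map_of_aemeasurable (by fun_prop) hpi,
    (iIndepFun_iff_map_fun_eq_pi_map fun i => (hU_law i).aemeasurable).1 hU_indep]
  simp_rw [fun i => (hU_law i).map_eq]

end Coordinates

/-! ### Lower bound by the dual certificate -/

section LowerBound

variable {m n k : ℕ} {H : Matrix (Fin n) (Fin m) ℝ} {Q : Matrix (Fin n) (Fin k) ℝ} {σ : Fin k → ℝ}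
  {V : Matrix (Fin m) (Fin k) ℝ}

/-- The joint law of `(U, HU)` for a standard Gaussian vector `U`. -/
noncomputable def sourceLaw (H : Matrix (Fin n) (Fin m) ℝ) :
    Measure (EuclideanSpace ℝ (Fin m) × EuclideanSpace ℝ (Fin n)) :=
  (stdGaussian (EuclideanSpace ℝ (Fin m))).map fun u => (u, H.toEuclideanLin u)

instance isProbabilityMeasure_sourceLaw : IsProbabilityMeasure (sourceLaw H) :=
  Measure.isProbabilityMeasure_map (by fun_prop)

lemma map_fst_sourceLaw :
    (sourceLaw H).map Prod.fst = stdGaussian (EuclideanSpace ℝ (Fin m)) := by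
  rw [sourceLaw, Measure.map_map (by fun_prop) (by fun_prop)]
  exact Measure.map_id

lemma ae_snd_sourceLaw : ∀ᵐ c ∂(sourceLaw H), c.2 = H.toEuclideanLin c.1 := by
  rw [sourceLaw, ae_map_iff (by fun_prop) (measurableSet_eq_fun (by fun_prop) (by fun_prop))]
  exact ae_of_all _ fun _ => rfl

section Joint

variable (κ : Kernel (EuclideanSpace ℝ (Fin m) × EuclideanSpace ℝ (Fin n))
  (EuclideanSpace ℝ (Fin n))) [IsMarkovKernel κ]

lemma map_fst_compProd_sourceLaw : (sourceLaw H ⊗ₘ κ).map Prod.fst = sourceLaw H :=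
  Measure.fst_compProd _ _

lemma map_source_compProd_sourceLaw : (sourceLaw H ⊗ₘ κ).map (fun w => w.1.1)
    = stdGaussian (EuclideanSpace ℝ (Fin m)) := by
  rw [← map_fst_sourceLaw (H := H), ← map_fst_compProd_sourceLaw κ,
    Measure.map_map (by fun_prop) (by fun_prop), map_fst_compProd_sourceLaw κ]
  rfl

lemma ae_compProd_sourceLaw : ∀ᵐ w ∂(sourceLaw H ⊗ₘ κ), w.1.2 = H.toEuclideanLin w.1.1 := by
  have h := ae_snd_sourceLaw (H := H)
  rw [← map_fst_compProd_sourceLaw κ] at h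
  exact ae_of_ae_map (by fun_prop) h

end Joint

lemma IsCompactSVD.measurePreserving_sourceCoord (hH : IsCompactSVD H Q σ V) {v : Fin k → ℝ≥0}
    (hv : ∀ i, (v i : ℝ) = σ i ^ 2) (i : Fin k) :
    MeasurePreserving (fun u => sourceCoord σ V u i) (stdGaussian (EuclideanSpace ℝ (Fin m)))
      (gaussianReal 0 (v i)) :=
  (measurePreserving_eval _ i).comp ⟨by fun_prop, hH.map_sourceCoord hv⟩

/-- For a fixed observation the independence of the source coordinates factors the exponential into
scalar bounds. -/
lemma IsCompactSVD.lintegral_exp_sum_rateTest_le_one (hH : IsCompactSVD H Q σ V)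
    {v d : Fin k → ℝ≥0} {τ : ℝ≥0} (hv : ∀ i, (v i : ℝ) = σ i ^ 2) (hτ : τ ≠ 0)
    (hd : ∀ i, d i = min (v i) τ) (w : Fin k → ℝ) :
    ∫⁻ u, ENNReal.ofReal (Real.exp (∑ i, rateTest (v i) (d i) τ (w i) (sourceCoord σ V u i)))
      ∂(stdGaussian (EuclideanSpace ℝ (Fin m))) ≤ 1 := by
  have hv0 : ∀ i, v i ≠ 0 := fun i h => by
    have := hv i
    have := hH.pos i
    simp_all [sq]
  have hm : ∀ i, Measurable fun z => ENNReal.ofReal (Real.exp (rateTest (v i) (d i) τ (w i) z)) :=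
    fun i => by unfold rateTest; fun_prop
  calc _ = ∫⁻ z, ∏ i, ENNReal.ofReal (Real.exp (rateTest (v i) (d i) τ (w i) (z i)))
        ∂(Measure.pi fun i => gaussianReal 0 (v i)) := by
        rw [← hH.map_sourceCoord hv, lintegral_map (by unfold rateTest; fun_prop) (by fun_prop)]
        simp_rw [Real.exp_sum]
        refine lintegral_congr fun u => ?_
        rw [ENNReal.ofReal_prod_of_nonneg fun i _ => (Real.exp_pos _).le]
    _ ≤ 1 := by
        rw [lintegral_pi_prod_eq_prod _ hm]
        exact Finset.prod_le_one' fun i _ => lintegral_exp_rateTest_le_one (w i) (hv0 i) hτ (hd i)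

lemma integrable_norm_sq_of_lintegral_le {α E : Type*} [MeasurableSpace α] [NormedAddCommGroup E]
    {μ : Measure α} {X : α → E} (hX : AEStronglyMeasurable X μ) {D : ℝ} (hD : 0 ≤ D)
    (h : ∫⁻ a, ‖X a‖ₑ ^ 2 ∂μ ≤ ENNReal.ofReal D) :
    Integrable (fun a => ‖X a‖ ^ 2) μ ∧ ∫ a, ‖X a‖ ^ 2 ∂μ ≤ D := by
  have hm : AEStronglyMeasurable (fun a => ‖X a‖ ^ 2) μ := hX.norm.pow 2
  have hsq : ∀ a, ENNReal.ofReal (‖X a‖ ^ 2) = ‖X a‖ₑ ^ 2 := fun a => by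
    rw [ENNReal.ofReal_pow (norm_nonneg _), ofReal_norm]
  constructor
  · refine (lintegral_ofReal_ne_top_iff_integrable hm (ae_of_all _ fun x => by positivity)).1 ?_
    simp_rw [hsq]
    exact ne_top_of_le_ne_top ENNReal.ofReal_ne_top h
  · rw [integral_eq_lintegral_of_nonneg_ae (ae_of_all _ fun x => by positivity) hm]
    simp_rw [hsq]
    exact ENNReal.toReal_le_of_le_ofReal hD h

/-- Since `Qᵀ Q = 1`, the source coordinates cancel from the difference and leave `-Qᵀ e`: the
penalty is the projected cost. -/
lemma IsCompactSVD.sum_rateTest_eq (hH : IsCompactSVD H Q σ V) (v d : Fin k → ℝ≥0) (τ : ℝ≥0)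
    (u : EuclideanSpace ℝ (Fin m)) (e : EuclideanSpace ℝ (Fin n)) :
    ∑ i, rateTest (v i) (d i) τ (Qᵀ.toEuclideanLin (H.toEuclideanLin u + e) i)
        (sourceCoord σ V u i) =
      (1 / 2 * ∑ i, Real.log (v i / d i)
        + ∑ i, (d i : ℝ) / (2 * v i * τ) * sourceCoord σ V u i ^ 2)
        - ‖Qᵀ.toEuclideanLin e‖ ^ 2 / (2 * τ) := by
  have hy : ∀ i, sourceCoord σ V u i - Qᵀ.toEuclideanLin (H.toEuclideanLin u + e) i
      = - Qᵀ.toEuclideanLin e i := fun i => by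
    rw [hH.toEuclideanLin_eq, map_add, hH.transpose_toEuclideanLin_left]
    simp
  simp only [rateTest, hy]
  rw [EuclideanSpace.real_norm_sq_eq]
  simp only [Finset.sum_sub_distrib, Finset.sum_add_distrib, ← Finset.mul_sum, ← Finset.sum_div,
    neg_sq]

/-- The expected value of the test function is at least the rate when the cost is within budget. -/
lemma IsCompactSVD.le_integral_sum_rateTest (hH : IsCompactSVD H Q σ V)
    {v d : Fin k → ℝ≥0} {τ : ℝ≥0} (hv : ∀ i, (v i : ℝ) = σ i ^ 2) (hτ : τ ≠ 0)
    {S : Measure ((EuclideanSpace ℝ (Fin m) × EuclideanSpace ℝ (Fin n)) ×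
      EuclideanSpace ℝ (Fin n))} [IsProbabilityMeasure S]
    (hlaw : S.map (fun w => w.1.1) = stdGaussian (EuclideanSpace ℝ (Fin m)))
    (hS : ∀ᵐ w ∂S, w.1.2 = H.toEuclideanLin w.1.1)
    (hcost : ∫⁻ w, ‖w.2‖ₑ ^ 2 ∂S ≤ ENNReal.ofReal (∑ i, (d i : ℝ))) :
    Integrable (fun w => ∑ i, rateTest (v i) (d i) τ (Qᵀ.toEuclideanLin (w.1.2 + w.2) i)
      (sourceCoord σ V w.1.1 i)) S ∧
    1 / 2 * ∑ i, Real.log (v i / d i) ≤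
      ∫ w, ∑ i, rateTest (v i) (d i) τ (Qᵀ.toEuclideanLin (w.1.2 + w.2) i)
        (sourceCoord σ V w.1.1 i) ∂S := by
  have hτ' : (0 : ℝ) < τ := NNReal.coe_pos.2 (pos_iff_ne_zero.2 hτ)
  have hvpos : ∀ i, (0 : ℝ) < v i := fun i => by rw [hv]; have := hH.pos i; positivity
  have hmp : ∀ i, MeasurePreserving (fun w => sourceCoord σ V w.1.1 i) S (gaussianReal 0 (v i)) :=
    fun i => (hH.measurePreserving_sourceCoord hv i).comp ⟨by fun_prop, hlaw⟩
  have hzint : ∀ i, Integrable (fun w => sourceCoord σ V w.1.1 i ^ 2) S := fun i =>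
    (hmp i).integrable_comp_of_integrable (integrable_sq_gaussianReal (v i))
  have hzval : ∀ i, ∫ w, sourceCoord σ V w.1.1 i ^ 2 ∂S = v i := fun i => by
    rw [← integral_sq_gaussianReal (v i), ← (hmp i).map_eq,
      integral_map (hmp i).measurable.aemeasurable (by fun_prop)]
  obtain ⟨heint, heval⟩ := integrable_norm_sq_of_lintegral_le
    (Measurable.aestronglyMeasurable (by fun_prop)) (by positivity) hcost
  have hle : ∀ e : EuclideanSpace ℝ (Fin n), ‖Qᵀ.toEuclideanLin e‖ ^ 2 ≤ ‖e‖ ^ 2 := fun e =>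
    pow_le_pow_left₀ (norm_nonneg _) (norm_transpose_toEuclideanLin_le hH.orthonormal_left e) 2
  have hqint : Integrable (fun w => ‖Qᵀ.toEuclideanLin w.2‖ ^ 2) S := by
    refine heint.mono (Measurable.aestronglyMeasurable (by fun_prop)) (ae_of_all _ fun w => ?_)
    rw [Real.norm_of_nonneg (by positivity), Real.norm_of_nonneg (by positivity)]
    exact hle _
  have hqval : ∫ w, ‖Qᵀ.toEuclideanLin w.2‖ ^ 2 ∂S ≤ ∑ i, (d i : ℝ) :=
    (integral_mono hqint heint fun w => hle _).trans heval
  have hsumint : Integrable (fun w => ∑ i, (d i : ℝ) / (2 * v i * τ) *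
      sourceCoord σ V w.1.1 i ^ 2) S :=
    integrable_finsetSum _ fun i _ => (hzint i).const_mul _
  have haddint : Integrable (fun w => 1 / 2 * ∑ i, Real.log (v i / d i) +
      ∑ i, (d i : ℝ) / (2 * v i * τ) * sourceCoord σ V w.1.1 i ^ 2) S :=
    (integrable_const _).add hsumint
  have hqint' := hqint.div_const (2 * (τ : ℝ))
  have hae : (fun w => ∑ i, rateTest (v i) (d i) τ (Qᵀ.toEuclideanLin (w.1.2 + w.2) i)
      (sourceCoord σ V w.1.1 i)) =ᵐ[S] fun w =>
      (1 / 2 * ∑ i, Real.log (v i / d i)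
        + ∑ i, (d i : ℝ) / (2 * v i * τ) * sourceCoord σ V w.1.1 i ^ 2)
        - ‖Qᵀ.toEuclideanLin w.2‖ ^ 2 / (2 * τ) := by
    filter_upwards [hS] with w hw
    rw [hw, hH.sum_rateTest_eq]
  refine ⟨(integrable_congr hae).2 (haddint.sub hqint'), ?_⟩
  rw [integral_congr_ae hae, integral_sub haddint hqint', integral_add (integrable_const _) hsumint,
    integral_finsetSum _ fun i _ => (hzint i).const_mul _, integral_div]
  simp_rw [integral_const_mul, hzval]
  -- With `𝔼 (z i)² = v i`, the quadratic reward is `∑ d i / (2 τ)`, which pays exactly for the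
  -- largest admissible penalty.
  have h1 : ∑ i, (d i : ℝ) / (2 * v i * τ) * v i = (∑ i, (d i : ℝ)) / (2 * τ) := by
    rw [Finset.sum_div]
    refine Finset.sum_congr rfl fun i _ => ?_
    have := (hvpos i).ne'
    field_simp
  have h2 : (∫ w, ‖Qᵀ.toEuclideanLin w.2‖ ^ 2 ∂S) / (2 * τ) ≤ (∑ i, (d i : ℝ)) / (2 * τ) := by
    gcongr
  simp only [integral_const, probReal_univ, smul_eq_mul, one_mul]
  linarith

/-- Under the product of the marginals `y` can be frozen, so an exponential moment bound for each
fixed `y` suffices, whatever the law of `Y`. -/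
lemma ofReal_integral_le_mutualInfo {Ω α β : Type*} [MeasurableSpace Ω] [MeasurableSpace α]
    [MeasurableSpace β] {P : Measure Ω} [IsProbabilityMeasure P] {X : Ω → α} {Y : Ω → β}
    (hX : Measurable X) (hY : Measurable Y) {F : α × β → ℝ} (hF : Measurable F)
    (hFint : Integrable (fun ω => F (X ω, Y ω)) P)
    (hle : ∀ y, ∫⁻ x, ENNReal.ofReal (Real.exp (F (x, y))) ∂(P.map X) ≤ 1) :
    ENNReal.ofReal (∫ ω, F (X ω, Y ω) ∂P) ≤ mutualInfo P X Y := by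
  have hXY : Measurable fun ω => (X ω, Y ω) := hX.prodMk hY
  have := Measure.isProbabilityMeasure_map (μ := P) hXY.aemeasurable
  have := Measure.isProbabilityMeasure_map (μ := P) hX.aemeasurable
  have := Measure.isProbabilityMeasure_map (μ := P) hY.aemeasurable
  rw [← integral_map (f := F) hXY.aemeasurable hF.aestronglyMeasurable]
  refine ofReal_integral_le_klDiv hF
    ((integrable_map_measure hF.aestronglyMeasurable hXY.aemeasurable).2 hFint) ?_
  rw [lintegral_prod_symm _ (by fun_prop)]
  calc _ ≤ ∫⁻ _, 1 ∂(P.map Y) := lintegral_mono hle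
    _ = 1 := by simp

lemma IsCompactSVD.le_attackedInfo (hH : IsCompactSVD H Q σ V)
    {v d : Fin k → ℝ≥0} {τ : ℝ≥0} (hv : ∀ i, (v i : ℝ) = σ i ^ 2) (hτ : τ ≠ 0)
    (hd : ∀ i, d i = min (v i) τ)
    {κ : Kernel (EuclideanSpace ℝ (Fin m) × EuclideanSpace ℝ (Fin n)) (EuclideanSpace ℝ (Fin n))}
    (hκ : κ ∈ admissible (sourceLaw H) (∑ i, (d i : ℝ))) :
    ENNReal.ofReal (1 / 2 * ∑ i, Real.log (v i / d i)) ≤ attackedInfo (sourceLaw H) κ := by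
  obtain ⟨hκm, hcost⟩ := hκ
  have hlaw := map_source_compProd_sourceLaw (H := H) κ
  obtain ⟨hFint, hFval⟩ := hH.le_integral_sum_rateTest hv hτ hlaw (ae_compProd_sourceLaw κ) hcost
  have hFm : Measurable fun c : EuclideanSpace ℝ (Fin m) × EuclideanSpace ℝ (Fin n) =>
      ∑ i, rateTest (v i) (d i) τ (Qᵀ.toEuclideanLin c.2 i) (sourceCoord σ V c.1 i) := by
    unfold rateTest; fun_prop
  have hinfo := ofReal_integral_le_mutualInfo (P := sourceLaw H ⊗ₘ κ) (X := fun w => w.1.1)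
    (Y := fun w => w.1.2 + w.2) (by fun_prop) (by fun_prop) hFm hFint fun y => by
      rw [hlaw]
      exact hH.lintegral_exp_sum_rateTest_le_one hv hτ hd fun i => Qᵀ.toEuclideanLin y i
  exact (ENNReal.ofReal_le_ofReal hFval).trans hinfo

end LowerBound

/-! ### Upper bound by the reverse channel -/

section UpperBound

variable {m n k : ℕ} {H : Matrix (Fin n) (Fin m) ℝ} {Q : Matrix (Fin n) (Fin k) ℝ} {σ : Fin k → ℝ}
  {V : Matrix (Fin m) (Fin k) ℝ}

lemma map_toLp_pi_gaussianReal (d : Fin k → ℝ≥0) :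
    (Measure.pi fun i => gaussianReal 0 (d i)).map (WithLp.toLp 2) =
      multivariateGaussian 0 (Matrix.diagonal fun i => (d i : ℝ)) := by
  have hpsd : (Matrix.diagonal fun i => (d i : ℝ)).PosSemidef :=
    Matrix.PosSemidef.diagonal fun i => (d i).coe_nonneg
  refine Measure.ext_of_charFun (funext fun t => ?_)
  rw [charFun_pi, charFun_multivariateGaussian hpsd]
  simp_rw [charFun_gaussianReal]
  rw [← Complex.exp_sum]
  congr 1
  simp only [Complex.ofReal_zero, mul_zero, zero_mul, zero_sub, inner_zero_right, dotProduct,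
    Matrix.mulVec_diagonal, Finset.sum_neg_distrib]
  push_cast
  rw [Finset.sum_div]
  congr 1
  exact Finset.sum_congr rfl fun i _ => by ring

/-- The condition `a + d = v` gives `W - Λ` variance `v`, so both quadratic terms have mean `1 / 2`
and cancel. -/
lemma integral_gaussianLlr {a v d : ℝ≥0} (hv : v ≠ 0) (hd : d ≠ 0) (had : a + d = v) :
    Integrable (fun c => gaussianLlr v d c.1 c.2)
      (((gaussianReal 0 a).prod (gaussianReal 0 d)).map fun c => (c.1, c.1 - c.2)) ∧
    ∫ c, gaussianLlr v d c.1 c.2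
      ∂(((gaussianReal 0 a).prod (gaussianReal 0 d)).map fun c => (c.1, c.1 - c.2)) =
        1 / 2 * Real.log (v / d) := by
  have hv' : (v : ℝ) ≠ 0 := NNReal.coe_ne_zero.2 hv
  have hd' : (d : ℝ) ≠ 0 := NNReal.coe_ne_zero.2 hd
  have hm : Measurable fun c : ℝ × ℝ => gaussianLlr v d c.1 c.2 := by
    unfold gaussianLlr; fun_prop
  have hz : MeasurePreserving (fun c : ℝ × ℝ => c.1 - c.2)
      ((gaussianReal 0 a).prod (gaussianReal 0 d)) (gaussianReal 0 v) :=
    ⟨by fun_prop, by rw [map_sub_gaussianReal, had]⟩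
  have hl : MeasurePreserving (fun c : ℝ × ℝ => c.2)
      ((gaussianReal 0 a).prod (gaussianReal 0 d)) (gaussianReal 0 d) := measurePreserving_snd
  have hzint : Integrable (fun c : ℝ × ℝ => (c.1 - c.2) ^ 2 / (2 * v))
      ((gaussianReal 0 a).prod (gaussianReal 0 d)) :=
    (hz.integrable_comp_of_integrable (integrable_sq_gaussianReal v)).div_const _
  have hlint : Integrable (fun c : ℝ × ℝ => c.2 ^ 2 / (2 * d))
      ((gaussianReal 0 a).prod (gaussianReal 0 d)) :=
    (hl.integrable_comp_of_integrable (integrable_sq_gaussianReal d)).div_const _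
  have hzval : ∫ c : ℝ × ℝ, (c.1 - c.2) ^ 2 ∂((gaussianReal 0 a).prod (gaussianReal 0 d)) = v := by
    rw [← integral_sq_gaussianReal v, ← hz.map_eq,
      integral_map hz.measurable.aemeasurable (by fun_prop)]
  have hlval : ∫ c : ℝ × ℝ, c.2 ^ 2 ∂((gaussianReal 0 a).prod (gaussianReal 0 d)) = d := by
    rw [← integral_sq_gaussianReal d]
    exact integral_fun_snd (fun x : ℝ => x ^ 2) |>.trans (by simp)
  have haddint : Integrable (fun c : ℝ × ℝ => 1 / 2 * Real.log (v / d) +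
      (c.1 - c.2) ^ 2 / (2 * v)) ((gaussianReal 0 a).prod (gaussianReal 0 d)) :=
    (integrable_const _).add hzint
  have heq : ∀ c : ℝ × ℝ, gaussianLlr v d c.1 (c.1 - c.2) =
      1 / 2 * Real.log (v / d) + (c.1 - c.2) ^ 2 / (2 * v) - c.2 ^ 2 / (2 * d) := fun c => by
    unfold gaussianLlr; ring
  constructor
  · rw [integrable_map_measure hm.aestronglyMeasurable (by fun_prop)]
    refine (integrable_congr (ae_of_all _ heq)).2 (haddint.sub hlint)
  · rw [integral_map (by fun_prop) hm.aestronglyMeasurable]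
    simp_rw [heq]
    rw [integral_sub haddint hlint, integral_add (integrable_const _) hzint, integral_div,
      integral_div, hzval, hlval]
    simp only [integral_const, probReal_univ, smul_eq_mul, one_mul]
    field_simp
    ring

/-- Independent Gaussian pairs `(W i, Λ i)` together with an independent standard Gaussian
vector. -/
noncomputable def reverseBase (m : ℕ) (a d : Fin k → ℝ≥0) :
    Measure ((Fin k → ℝ × ℝ) × EuclideanSpace ℝ (Fin m)) :=
  (Measure.pi fun i => (gaussianReal 0 (a i)).prod (gaussianReal 0 (d i))).prod
    (stdGaussian (EuclideanSpace ℝ (Fin m)))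

instance isProbabilityMeasure_reverseBase (a d : Fin k → ℝ≥0) :
    IsProbabilityMeasure (reverseBase m a d) := by
  unfold reverseBase; infer_instance

/-- The source vector with coordinates `W - Λ`. -/
noncomputable def reverseSource (σ : Fin k → ℝ) (V : Matrix (Fin m) (Fin k) ℝ)
    (c : (Fin k → ℝ × ℝ) × EuclideanSpace ℝ (Fin m)) : EuclideanSpace ℝ (Fin m) :=
  sourceMix σ V (fun i => (c.1 i).1 - (c.1 i).2) c.2

@[fun_prop]
lemma measurable_reverseSource : Measurable (reverseSource σ V) :=
  (measurable_sourceMix σ V).comp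
    (f := fun c : (Fin k → ℝ × ℝ) × EuclideanSpace ℝ (Fin m) =>
      ((fun i => (c.1 i).1 - (c.1 i).2 : Fin k → ℝ), c.2)) (by fun_prop)

/-- The joint law of `((U, HU), Λ)` in the reverse construction, in which `Λ` is independent of
`W = σ Vᵀ U + Λ`. -/
noncomputable def reverseLaw (H : Matrix (Fin n) (Fin m) ℝ) (σ : Fin k → ℝ)
    (V : Matrix (Fin m) (Fin k) ℝ) (a d : Fin k → ℝ≥0) :
    Measure ((EuclideanSpace ℝ (Fin m) × EuclideanSpace ℝ (Fin n)) × EuclideanSpace ℝ (Fin k)) :=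
  (reverseBase m a d).map fun c =>
    ((reverseSource σ V c, H.toEuclideanLin (reverseSource σ V c)),
      WithLp.toLp 2 fun i => (c.1 i).2)

instance isProbabilityMeasure_reverseLaw (a d : Fin k → ℝ≥0) :
    IsProbabilityMeasure (reverseLaw H σ V a d) :=
  Measure.isProbabilityMeasure_map (by fun_prop)

/-- The law of a function of `((U, HU), Λ)` may be computed on the base space. -/
lemma measurePreserving_of_comp_reverse {α : Type*} [MeasurableSpace α] {a d : Fin k → ℝ≥0}
    {f : (EuclideanSpace ℝ (Fin m) × EuclideanSpace ℝ (Fin n)) × EuclideanSpace ℝ (Fin k) → α}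
    (hf : Measurable f) {g : (Fin k → ℝ × ℝ) × EuclideanSpace ℝ (Fin m) → α} {ν : Measure α}
    (hg : MeasurePreserving g (reverseBase m a d) ν)
    (hfg : ∀ c, f ((reverseSource σ V c, H.toEuclideanLin (reverseSource σ V c)),
      WithLp.toLp 2 fun i => (c.1 i).2) = g c) :
    MeasurePreserving f (reverseLaw H σ V a d) ν := by
  refine ⟨hf, ?_⟩
  rw [← hg.map_eq, reverseLaw, Measure.map_map hf (by fun_prop)]
  exact congrArg (Measure.map · _) (funext hfg)

lemma measurePreserving_reversePair (a d : Fin k → ℝ≥0) (i : Fin k) :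
    MeasurePreserving (fun c => c.1 i) (reverseBase m a d)
      ((gaussianReal 0 (a i)).prod (gaussianReal 0 (d i))) :=
  (measurePreserving_eval (fun i => (gaussianReal 0 (a i)).prod (gaussianReal 0 (d i))) i).comp
    measurePreserving_fst

lemma measurePreserving_reverseNoise (a d : Fin k → ℝ≥0) :
    MeasurePreserving (fun c i => (c.1 i).2) (reverseBase m a d)
      (Measure.pi fun i => gaussianReal 0 (d i)) :=
  (measurePreserving_pi (f := fun _ c => c.2)
    (fun i => (gaussianReal 0 (a i)).prod (gaussianReal 0 (d i)))
    (fun i => gaussianReal 0 (d i)) fun _ => measurePreserving_snd).comp measurePreserving_fst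

lemma IsCompactSVD.measurePreserving_reverseSource (hH : IsCompactSVD H Q σ V)
    {v a d : Fin k → ℝ≥0} (hv : ∀ i, (v i : ℝ) = σ i ^ 2) (had : ∀ i, a i + d i = v i) :
    MeasurePreserving (reverseSource σ V) (reverseBase m a d)
      (stdGaussian (EuclideanSpace ℝ (Fin m))) := by
  have h1 : MeasurePreserving (fun (c : Fin k → ℝ × ℝ) i => (c i).1 - (c i).2)
      (Measure.pi fun i => (gaussianReal 0 (a i)).prod (gaussianReal 0 (d i)))
      (Measure.pi fun i => gaussianReal 0 (v i)) :=
    measurePreserving_pi (f := fun _ (c : ℝ × ℝ) => c.1 - c.2)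
      (fun i => (gaussianReal 0 (a i)).prod (gaussianReal 0 (d i)))
      (fun i => gaussianReal 0 (v i)) fun i =>
      ⟨by fun_prop, by rw [map_sub_gaussianReal, had]⟩
  have h2 : MeasurePreserving (fun c => sourceMix σ V c.1 c.2)
      ((Measure.pi fun i => gaussianReal 0 (v i)).prod (stdGaussian (EuclideanSpace ℝ (Fin m))))
      (stdGaussian (EuclideanSpace ℝ (Fin m))) := ⟨by fun_prop, hH.map_sourceMix hv⟩
  have h3 := h2.comp (h1.prod (MeasurePreserving.id (stdGaussian (EuclideanSpace ℝ (Fin m)))))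
  exact h3

lemma IsCompactSVD.fst_reverseLaw (hH : IsCompactSVD H Q σ V)
    {v a d : Fin k → ℝ≥0} (hv : ∀ i, (v i : ℝ) = σ i ^ 2) (had : ∀ i, a i + d i = v i) :
    (reverseLaw H σ V a d).fst = sourceLaw H := by
  have h : MeasurePreserving (fun u => (u, H.toEuclideanLin u))
      (stdGaussian (EuclideanSpace ℝ (Fin m))) (sourceLaw H) := ⟨by fun_prop, rfl⟩
  exact (measurePreserving_of_comp_reverse measurable_fst
    (h.comp (hH.measurePreserving_reverseSource hv had)) fun c => rfl).map_eq

/-- The reverse construction gives a joint law, whereas an attack is a kernel. As the first marginal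
is the true source law, disintegration loses nothing, and properties of the joint law pass to the
attack. -/
lemma IsCompactSVD.compProd_condKernel_reverseLaw (hH : IsCompactSVD H Q σ V)
    {v a d : Fin k → ℝ≥0} (hv : ∀ i, (v i : ℝ) = σ i ^ 2) (had : ∀ i, a i + d i = v i) :
    sourceLaw H ⊗ₘ (reverseLaw H σ V a d).condKernel = reverseLaw H σ V a d := by
  rw [← hH.fst_reverseLaw hv had]
  exact (reverseLaw H σ V a d).disintegrate _

lemma measurePreserving_noise_reverseLaw (a d : Fin k → ℝ≥0) :
    MeasurePreserving (fun w i => w.2 i) (reverseLaw H σ V a d)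
      (Measure.pi fun i => gaussianReal 0 (d i)) :=
  measurePreserving_of_comp_reverse (by fun_prop) (measurePreserving_reverseNoise a d) fun _ => rfl

lemma measurePreserving_noise_apply_reverseLaw (a d : Fin k → ℝ≥0) (i : Fin k) :
    MeasurePreserving (fun w => w.2 i) (reverseLaw H σ V a d) (gaussianReal 0 (d i)) :=
  (measurePreserving_eval (fun i => gaussianReal 0 (d i)) i).comp
    (measurePreserving_noise_reverseLaw a d)

lemma hasLaw_noise_reverseLaw (a d : Fin k → ℝ≥0) :
    HasLaw (fun w => w.2) (multivariateGaussian 0 (Matrix.diagonal fun i => (d i : ℝ)))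
      (reverseLaw H σ V a d) := by
  have h : MeasurePreserving (WithLp.toLp 2) (Measure.pi fun i => gaussianReal 0 (d i))
      (multivariateGaussian 0 (Matrix.diagonal fun i => (d i : ℝ))) :=
    ⟨by fun_prop, map_toLp_pi_gaussianReal d⟩
  exact (h.comp (measurePreserving_noise_reverseLaw a d)).hasLaw

lemma iIndepFun_noise_reverseLaw (a d : Fin k → ℝ≥0) :
    iIndepFun (fun i w => w.2 i) (reverseLaw H σ V a d) := by
  rw [iIndepFun_iff_map_fun_eq_pi_map fun i => by fun_prop,
    (measurePreserving_noise_reverseLaw a d).map_eq]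
  simp_rw [fun i => (measurePreserving_noise_apply_reverseLaw (H := H) (σ := σ) (V := V)
    a d i).map_eq]

lemma IsCompactSVD.indepFun_reverseLaw (hH : IsCompactSVD H Q σ V) (a d : Fin k → ℝ≥0)
    (i : Fin k) : IndepFun (fun w => σ i * (∑ j, V j i * w.1.1 j) + w.2 i) (fun w => w.2 i)
      (reverseLaw H σ V a d) := by
  have h : MeasurePreserving (fun w => (σ i * (∑ j, V j i * w.1.1 j) + w.2 i, w.2 i))
      (reverseLaw H σ V a d) ((gaussianReal 0 (a i)).prod (gaussianReal 0 (d i))) := by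
    refine measurePreserving_of_comp_reverse (by fun_prop) (measurePreserving_reversePair a d i)
      fun c => ?_
    have := congrFun (hH.sourceCoord_sourceMix (fun i => (c.1 i).1 - (c.1 i).2) c.2) i
    rw [sourceCoord] at this
    simp only [reverseSource, this, sub_add_cancel]
  rw [indepFun_iff_map_prod_eq_prod_map_map (by fun_prop) (by fun_prop), h.map_eq,
    (measurePreserving_noise_apply_reverseLaw a d i).map_eq]
  exact congrArg (Measure.prod · _) (measurePreserving_fst.comp h).map_eq.symm

lemma lintegral_ofReal_sum_sq {α : Type*} [MeasurableSpace α] {μ : Measure α}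
    {X : Fin k → α → ℝ} {v : Fin k → ℝ≥0}
    (hX : ∀ i, MeasurePreserving (X i) μ (gaussianReal 0 (v i))) :
    ∫⁻ a, ENNReal.ofReal (∑ i, X i a ^ 2) ∂μ = ENNReal.ofReal (∑ i, (v i : ℝ)) := by
  have hint : ∀ i, Integrable (fun a => X i a ^ 2) μ := fun i =>
    (hX i).integrable_comp_of_integrable (integrable_sq_gaussianReal (v i))
  have hval : ∀ i, ∫ a, X i a ^ 2 ∂μ = v i := fun i => by
    rw [← integral_sq_gaussianReal (v i), ← (hX i).map_eq,
      integral_map (hX i).measurable.aemeasurable (by fun_prop)]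
  rw [← ofReal_integral_eq_lintegral_ofReal (integrable_finsetSum _ fun i _ => hint i)
    (ae_of_all _ fun w => Finset.sum_nonneg fun i _ => sq_nonneg _),
    integral_finsetSum _ fun i _ => hint i]
  simp_rw [hval]

lemma enorm_toEuclideanLin_sq {Q : Matrix (Fin n) (Fin k) ℝ} (hQ : Qᵀ * Q = 1)
    (x : EuclideanSpace ℝ (Fin k)) :
    ‖Q.toEuclideanLin x‖ₑ ^ 2 = ENNReal.ofReal (∑ i, x i ^ 2) := by
  rw [← EuclideanSpace.real_norm_sq_eq, ENNReal.ofReal_pow (norm_nonneg _),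
    ← norm_toEuclideanLin_of_orthonormal hQ, ofReal_norm]

lemma klDiv_pi_of_withDensity_exp {ι : Type*} [Fintype ι] {X : ι → Type*}
    [∀ i, MeasurableSpace (X i)] {μ ν : ∀ i, Measure (X i)} [∀ i, IsProbabilityMeasure (μ i)]
    [∀ i, IsProbabilityMeasure (ν i)] {g : ∀ i, X i → ℝ} (hg : ∀ i, Measurable (g i))
    (h : ∀ i, μ i = (ν i).withDensity fun x => ENNReal.ofReal (Real.exp (g i x)))
    (hint : ∀ i, Integrable (g i) (μ i)) :
    klDiv (Measure.pi μ) (Measure.pi ν) = ENNReal.ofReal (∑ i, ∫ x, g i x ∂(μ i)) := by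
  have hint' : ∀ i, Integrable (fun x : ∀ i, X i => g i (x i)) (Measure.pi μ) := fun i =>
    (measurePreserving_eval μ i).integrable_comp_of_integrable (hint i)
  have hdens := pi_withDensity μ ν (fun i => (hg i).exp.ennreal_ofReal) h
  have hm : Measurable fun x : ∀ i, X i => ∑ i, g i (x i) :=
    Finset.measurable_sum _ fun i _ => (hg i).comp (measurable_pi_apply i)
  rw [klDiv_withDensity_exp hm ?_ (integrable_finsetSum _ fun i _ => hint' i),
    integral_finsetSum _ fun i _ => hint' i]
  · congr 1
    refine Finset.sum_congr rfl fun i _ => ?_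
    have h1 := integral_map (φ := Function.eval i) (μ := Measure.pi μ)
      (measurable_pi_apply i).aemeasurable
      ((hg i).aestronglyMeasurable (μ := (Measure.pi μ).map (Function.eval i)))
    rw [(measurePreserving_eval μ i).map_eq] at h1
    exact h1.symm
  · rw [hdens]
    simp_rw [Real.exp_sum, ENNReal.ofReal_prod_of_nonneg fun i _ => (Real.exp_pos _).le]

lemma klDiv_pi_reverse {v a d : Fin k → ℝ≥0} (hv : ∀ i, v i ≠ 0) (hd : ∀ i, d i ≠ 0)
    (had : ∀ i, a i + d i = v i) :
    klDiv (Measure.pi fun i => ((gaussianReal 0 (a i)).prod (gaussianReal 0 (d i))).map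
        fun c => (c.1, c.1 - c.2))
      (Measure.pi fun i => (gaussianReal 0 (a i)).prod (gaussianReal 0 (v i))) =
      ENNReal.ofReal (1 / 2 * ∑ i, Real.log (v i / d i)) := by
  have hp : ∀ i, IsProbabilityMeasure (((gaussianReal 0 (a i)).prod (gaussianReal 0 (d i))).map
      fun c => (c.1, c.1 - c.2)) := fun i => Measure.isProbabilityMeasure_map (by fun_prop)
  have hm : ∀ i, Measurable fun c : ℝ × ℝ => gaussianLlr (v i) (d i) c.1 c.2 := fun i => by
    unfold gaussianLlr; fun_prop
  rw [klDiv_pi_of_withDensity_exp hm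
    (fun i => map_prod_sub_gaussianReal (a i) (hv i) (hd i))
    fun i => (integral_gaussianLlr (hv i) (hd i) (had i)).1, Finset.mul_sum]
  simp_rw [fun i => (integral_gaussianLlr (hv i) (hd i) (had i)).2]

/-- The pair of the source vector with coordinates `z` and the observation `Q w`. -/
noncomputable def pairMap (Q : Matrix (Fin n) (Fin k) ℝ) (σ : Fin k → ℝ)
    (V : Matrix (Fin m) (Fin k) ℝ) (c : (Fin k → ℝ × ℝ) × EuclideanSpace ℝ (Fin m)) :
    EuclideanSpace ℝ (Fin m) × EuclideanSpace ℝ (Fin n) :=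
  (sourceMix σ V (fun i => (c.1 i).2) c.2, Q.toEuclideanLin (WithLp.toLp 2 fun i => (c.1 i).1))

lemma measurable_pairMap : Measurable (pairMap Q σ V) :=
  ((measurable_sourceMix σ V).comp
    (f := fun c : (Fin k → ℝ × ℝ) × EuclideanSpace ℝ (Fin m) =>
      ((fun i => (c.1 i).2 : Fin k → ℝ), c.2)) (by fun_prop)).prodMk (by fun_prop)

/-- With independent coordinates, the source vector and the observation are independent. -/
lemma IsCompactSVD.measurePreserving_pairMap (hH : IsCompactSVD H Q σ V)
    {v : Fin k → ℝ≥0} (hv : ∀ i, (v i : ℝ) = σ i ^ 2) (a : Fin k → ℝ≥0) :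
    MeasurePreserving (pairMap Q σ V) (reverseBase m a v)
      ((stdGaussian (EuclideanSpace ℝ (Fin m))).prod
        (((Measure.pi fun i => gaussianReal 0 (a i)).map (WithLp.toLp 2)).map
          Q.toEuclideanLin)) := by
  set A := Measure.pi fun i => gaussianReal 0 (a i)
  set B := Measure.pi fun i => gaussianReal 0 (v i)
  set G := stdGaussian (EuclideanSpace ℝ (Fin m))
  -- The pairs `(w i, z i)` and `g` are regrouped as `((z, g), w)`, so that the two outputs use
  -- disjoint independent blocks.
  have h1 : MeasurePreserving (MeasurableEquiv.arrowProdEquivProdArrow ℝ ℝ (Fin k))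
      (Measure.pi fun i => (gaussianReal 0 (a i)).prod (gaussianReal 0 (v i))) (A.prod B) :=
    measurePreserving_arrowProdEquivProdArrow ℝ ℝ (Fin k) _ _
  have h2 := h1.prod (MeasurePreserving.id G)
  have h3 := (measurePreserving_prodAssoc A B G).comp h2
  have h4 := (Measure.measurePreserving_swap (μ := A) (ν := B.prod G)).comp h3
  have h5 : MeasurePreserving (fun c => sourceMix σ V c.1 c.2) (B.prod G) G :=
    ⟨by fun_prop, hH.map_sourceMix hv⟩
  have h6 : MeasurePreserving (fun w => Q.toEuclideanLin (WithLp.toLp 2 w)) A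
      ((A.map (WithLp.toLp 2)).map Q.toEuclideanLin) :=
    ⟨by fun_prop, by rw [Measure.map_map (by fun_prop) (by fun_prop)]; rfl⟩
  have h7 := (h5.prod h6).comp h4
  exact h7

lemma IsCompactSVD.compProd_optimal (hH : IsCompactSVD H Q σ V)
    {v a d : Fin k → ℝ≥0} (hv : ∀ i, (v i : ℝ) = σ i ^ 2) (had : ∀ i, a i + d i = v i) :
    sourceLaw H ⊗ₘ (reverseLaw H σ V a d).condKernel.map Q.toEuclideanLin =
      (reverseLaw H σ V a d).map (Prod.map id Q.toEuclideanLin) := by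
  rw [Measure.compProd_map (measurable_toEuclideanLin Q),
    hH.compProd_condKernel_reverseLaw hv had]

lemma IsCompactSVD.optimal_mem_admissible (hH : IsCompactSVD H Q σ V)
    {v a d : Fin k → ℝ≥0} (hv : ∀ i, (v i : ℝ) = σ i ^ 2) (had : ∀ i, a i + d i = v i) :
    (reverseLaw H σ V a d).condKernel.map Q.toEuclideanLin ∈
      admissible (sourceLaw H) (∑ i, (d i : ℝ)) := by
  refine ⟨Kernel.IsMarkovKernel.map _ (measurable_toEuclideanLin Q), ?_⟩
  rw [hH.compProd_optimal hv had, lintegral_map (by fun_prop) (by fun_prop)]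
  simp only [Prod.map_snd, enorm_toEuclideanLin_sq hH.orthonormal_left]
  exact (lintegral_ofReal_sum_sq (measurePreserving_noise_apply_reverseLaw a d)).le

/-- The noise cancels: `Q (W - Λ) + Q Λ = Q W`. Hence the observation depends on `W` alone. -/
lemma IsCompactSVD.toEuclideanLin_reverseSource_add (hH : IsCompactSVD H Q σ V)
    (c : (Fin k → ℝ × ℝ) × EuclideanSpace ℝ (Fin m)) :
    H.toEuclideanLin (reverseSource σ V c) + Q.toEuclideanLin (WithLp.toLp 2 fun i => (c.1 i).2) =
      Q.toEuclideanLin (WithLp.toLp 2 fun i => (c.1 i).1) := by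
  rw [hH.toEuclideanLin_eq, reverseSource, hH.sourceCoord_sourceMix, ← map_add]
  congr 1
  ext i
  simp

lemma IsCompactSVD.measurePreserving_joint_reverseLaw (hH : IsCompactSVD H Q σ V)
    (a d : Fin k → ℝ≥0) :
    MeasurePreserving (fun w => (w.1.1, w.1.2 + Q.toEuclideanLin w.2)) (reverseLaw H σ V a d)
      (((Measure.pi fun i => ((gaussianReal 0 (a i)).prod (gaussianReal 0 (d i))).map
        fun c => (c.1, c.1 - c.2)).prod (stdGaussian (EuclideanSpace ℝ (Fin m)))).map
          (pairMap Q σ V)) := by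
  have hp : ∀ i, IsProbabilityMeasure (((gaussianReal 0 (a i)).prod (gaussianReal 0 (d i))).map
      fun c => (c.1, c.1 - c.2)) := fun i => Measure.isProbabilityMeasure_map (by fun_prop)
  have h1 : MeasurePreserving (fun (c : Fin k → ℝ × ℝ) i => ((c i).1, (c i).1 - (c i).2))
      (Measure.pi fun i => (gaussianReal 0 (a i)).prod (gaussianReal 0 (d i)))
      (Measure.pi fun i => ((gaussianReal 0 (a i)).prod (gaussianReal 0 (d i))).map
        fun c => (c.1, c.1 - c.2)) :=
    measurePreserving_pi (f := fun _ (c : ℝ × ℝ) => (c.1, c.1 - c.2)) _ _ fun i =>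
      ⟨by fun_prop, rfl⟩
  have h2 := h1.prod (MeasurePreserving.id (stdGaussian (EuclideanSpace ℝ (Fin m))))
  have h3 := (measurable_pairMap (Q := Q) (σ := σ) (V := V)).measurePreserving _ |>.comp h2
  refine measurePreserving_of_comp_reverse (by fun_prop) h3 fun c => ?_
  simp only [hH.toEuclideanLin_reverseSource_add]
  rfl

lemma IsCompactSVD.measurePreserving_observation_reverseLaw (hH : IsCompactSVD H Q σ V)
    (a d : Fin k → ℝ≥0) :
    MeasurePreserving (fun w => w.1.2 + Q.toEuclideanLin w.2) (reverseLaw H σ V a d)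
      (((Measure.pi fun i => gaussianReal 0 (a i)).map (WithLp.toLp 2)).map
          Q.toEuclideanLin) := by
  have h1 : MeasurePreserving (fun (c : Fin k → ℝ × ℝ) i => (c i).1)
      (Measure.pi fun i => (gaussianReal 0 (a i)).prod (gaussianReal 0 (d i)))
      (Measure.pi fun i => gaussianReal 0 (a i)) :=
    measurePreserving_pi (f := fun _ (c : ℝ × ℝ) => c.1)
      (fun i => (gaussianReal 0 (a i)).prod (gaussianReal 0 (d i)))
      (fun i => gaussianReal 0 (a i)) fun i => measurePreserving_fst
  have h2 : MeasurePreserving (fun w => Q.toEuclideanLin (WithLp.toLp 2 w))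
      (Measure.pi fun i => gaussianReal 0 (a i))
      (((Measure.pi fun i => gaussianReal 0 (a i)).map (WithLp.toLp 2)).map Q.toEuclideanLin) :=
    ⟨by fun_prop, by rw [Measure.map_map (by fun_prop) (by fun_prop)]; rfl⟩
  have h3 : MeasurePreserving (Prod.fst : _ → Fin k → ℝ × ℝ) (reverseBase m a d)
    (Measure.pi fun i => (gaussianReal 0 (a i)).prod (gaussianReal 0 (d i))) :=
    measurePreserving_fst
  refine measurePreserving_of_comp_reverse (by fun_prop) (h2.comp (h1.comp h3)) fun c => ?_
  simp only [hH.toEuclideanLin_reverseSource_add]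
  rfl

lemma klDiv_prod_right {α β : Type*} [MeasurableSpace α] [MeasurableSpace β] (μ ν : Measure α)
    [IsFiniteMeasure μ] [IsFiniteMeasure ν] (ρ : Measure β) [IsProbabilityMeasure ρ] :
    klDiv (μ.prod ρ) (ν.prod ρ) = klDiv μ ν := by
  rw [← Measure.compProd_const, ← Measure.compProd_const, klDiv_compProd_left]

/-- The joint law and the product of its marginals are images of product measures under the same
`pairMap`, so data processing applies. An inequality is enough, since the lower bound supplies the
converse. -/
lemma IsCompactSVD.attackedInfo_optimal_le (hH : IsCompactSVD H Q σ V)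
    {v a d : Fin k → ℝ≥0} (hv : ∀ i, (v i : ℝ) = σ i ^ 2) (had : ∀ i, a i + d i = v i)
    (hd : ∀ i, d i ≠ 0) :
    attackedInfo (sourceLaw H) ((reverseLaw H σ V a d).condKernel.map Q.toEuclideanLin) ≤
      ENNReal.ofReal (1 / 2 * ∑ i, Real.log (v i / d i)) := by
  have hv0 : ∀ i, v i ≠ 0 := fun i h => hd i (add_eq_zero.1 ((had i).trans h)).2
  have hM : IsMarkovKernel ((reverseLaw H σ V a d).condKernel.map Q.toEuclideanLin) :=
    Kernel.IsMarkovKernel.map _ (measurable_toEuclideanLin Q)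
  have hp : ∀ i, IsProbabilityMeasure (((gaussianReal 0 (a i)).prod (gaussianReal 0 (d i))).map
      fun c => (c.1, c.1 - c.2)) := fun i => Measure.isProbabilityMeasure_map (by fun_prop)
  have hjoint : (sourceLaw H ⊗ₘ (reverseLaw H σ V a d).condKernel.map Q.toEuclideanLin).map
      (fun w => (w.1.1, w.1.2 + w.2)) =
      (((Measure.pi fun i => ((gaussianReal 0 (a i)).prod (gaussianReal 0 (d i))).map
        fun c => (c.1, c.1 - c.2)).prod (stdGaussian (EuclideanSpace ℝ (Fin m)))).map
          (pairMap Q σ V)) := by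
    rw [hH.compProd_optimal hv had, Measure.map_map (by fun_prop) (by fun_prop)]
    exact (hH.measurePreserving_joint_reverseLaw a d).map_eq
  have hobs : (sourceLaw H ⊗ₘ (reverseLaw H σ V a d).condKernel.map Q.toEuclideanLin).map
      (fun w => w.1.2 + w.2) =
      (((Measure.pi fun i => gaussianReal 0 (a i)).map (WithLp.toLp 2)).map
          Q.toEuclideanLin) := by
    rw [hH.compProd_optimal hv had, Measure.map_map (by fun_prop) (by fun_prop)]
    exact (hH.measurePreserving_observation_reverseLaw a d).map_eq
  rw [attackedInfo, mutualInfo, hjoint, hobs, map_source_compProd_sourceLaw,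
    ← (hH.measurePreserving_pairMap hv a).map_eq, ← klDiv_pi_reverse hv0 hd had, reverseBase]
  refine (klDiv_map_le _ _ measurable_pairMap).trans ?_
  -- The auxiliary Gaussian vector is a common independent factor and drops out.
  rw [klDiv_prod_right]

end UpperBound

/-! ### Large budget: exact cancellation -/

section CancelAttack

variable {m n k : ℕ} {H : Matrix (Fin n) (Fin m) ℝ} {Q : Matrix (Fin n) (Fin k) ℝ} {σ : Fin k → ℝ}
  {V : Matrix (Fin m) (Fin k) ℝ}

instance isMarkovKernel_cancelAttack : IsMarkovKernel (cancelAttack H) := by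
  unfold cancelAttack; infer_instance

lemma compProd_cancelAttack : sourceLaw H ⊗ₘ cancelAttack H =
    (stdGaussian (EuclideanSpace ℝ (Fin m))).map
      fun u => ((u, H.toEuclideanLin u), -H.toEuclideanLin u) := by
  rw [cancelAttack, Measure.compProd_deterministic, sourceLaw,
    Measure.map_map (by fun_prop) (by fun_prop)]
  rfl

lemma IsCompactSVD.cancelAttack_mem_admissible (hH : IsCompactSVD H Q σ V) {D : ℝ}
    (hD : ∑ i, σ i ^ 2 ≤ D) : cancelAttack H ∈ admissible (sourceLaw H) D := by
  refine ⟨inferInstance, ?_⟩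
  rw [compProd_cancelAttack, lintegral_map (by fun_prop) (by fun_prop)]
  simp only [enorm_neg, hH.toEuclideanLin_eq, enorm_toEuclideanLin_sq hH.orthonormal_left]
  obtain ⟨v, hv⟩ : ∃ v : Fin k → ℝ≥0, ∀ i, (v i : ℝ) = σ i ^ 2 :=
    ⟨fun i => ⟨σ i ^ 2, sq_nonneg _⟩, fun _ => rfl⟩
  rw [lintegral_ofReal_sum_sq (hH.measurePreserving_sourceCoord hv)]
  simp_rw [hv]
  exact ENNReal.ofReal_le_ofReal hD

lemma attackedInfo_cancelAttack : attackedInfo (sourceLaw H) (cancelAttack H) = 0 := by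
  have hjoint : (sourceLaw H ⊗ₘ cancelAttack H).map (fun w => (w.1.1, w.1.2 + w.2)) =
      (stdGaussian (EuclideanSpace ℝ (Fin m))).prod
        (Measure.dirac (0 : EuclideanSpace ℝ (Fin n))) := by
    rw [compProd_cancelAttack, Measure.map_map (by fun_prop) (by fun_prop), Measure.prod_dirac]
    congr 1
    ext1 u
    simp
  have hobs : (sourceLaw H ⊗ₘ cancelAttack H).map (fun w => w.1.2 + w.2) =
      Measure.dirac (0 : EuclideanSpace ℝ (Fin n)) := by
    rw [compProd_cancelAttack, Measure.map_map (by fun_prop) (by fun_prop)]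
    have : ((fun w : (EuclideanSpace ℝ (Fin m) × EuclideanSpace ℝ (Fin n)) ×
        EuclideanSpace ℝ (Fin n) => w.1.2 + w.2) ∘
        fun u => ((u, H.toEuclideanLin u), -H.toEuclideanLin u)) = fun _ => 0 := by
      ext1 u; simp
    rw [this, Measure.map_const]
    simp
  rw [attackedInfo, mutualInfo, hjoint, hobs, map_source_compProd_sourceLaw, klDiv_self]

end CancelAttack

/-! ### Water level and conclusion -/

/-- Reverse water-filling: a total level `D` determines a water level `τ`. -/
lemma exists_waterLevel {k : ℕ} {s : Fin k → ℝ} (hs : ∀ i, 0 < s i) {D : ℝ} (hD : 0 < D)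
    (hDs : D ≤ ∑ i, s i) : ∃ τ, 0 < τ ∧ ∑ i, min (s i) τ = D := by
  have hcont : Continuous fun τ : ℝ => ∑ i, min (s i) τ := by fun_prop
  have h0 : ∑ i, min (s i) 0 = 0 := Finset.sum_eq_zero fun i _ => min_eq_right (hs i).le
  -- At level `∑ j, s j` no term is capped, which gives the upper endpoint for the intermediate
  -- value theorem.
  have h1 : ∑ i, min (s i) (∑ j, s j) = ∑ i, s i := Finset.sum_congr rfl fun i _ =>
    min_eq_left (Finset.single_le_sum (fun j _ => (hs j).le) (Finset.mem_univ i))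
  obtain ⟨τ, hτ, hval⟩ := intermediate_value_Icc (hD.le.trans hDs) hcont.continuousOn
    (show D ∈ Set.Icc _ _ from ⟨h0.trans_le hD.le, hDs.trans_eq h1.symm⟩)
  refine ⟨τ, hτ.1.lt_of_ne ?_, hval⟩
  rintro rfl
  exact hD.ne (h0.symm.trans hval)

theorem theorem2 {Ω : Type*} [MeasurableSpace Ω] (P : Measure Ω) [IsProbabilityMeasure P]
    {m n k : ℕ} (U : Ω → EuclideanSpace ℝ (Fin m))
    (hU_law : ∀ i, HasLaw (fun ω => U ω i) (gaussianReal 0 1) P)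
    (hU_indep : iIndepFun (fun i ω => U ω i) P)
    (H : Matrix (Fin n) (Fin m) ℝ) (hk : H.rank = k)
    (Q : Matrix (Fin n) (Fin k) ℝ) (σ : Fin k → ℝ) (V : Matrix (Fin m) (Fin k) ℝ)
    (hH : IsCompactSVD H Q σ V)
    (p : Measure (EuclideanSpace ℝ (Fin m) × EuclideanSpace ℝ (Fin n)))
    (hp : p = P.map fun ω => (U ω, H.toEuclideanLin (U ω)))
    (D : ℝ) :
    (0 < D → D ≤ ∑ i, σ i ^ 2 →
      ∃ τ : ℝ, 0 < τ ∧ ∃ d : Fin k → ℝ,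
        (∀ i, d i = min (σ i ^ 2) τ) ∧ ∑ i, d i = D ∧
        IsLeast (attackedInfo p '' admissible p D)
          (ENNReal.ofReal (1 / 2 * ∑ i, Real.log (σ i ^ 2 / d i))) ∧
        -- an optimal `E = QΛ`, where `L` is the conditional law of `Λ` given `(U, X)`
        ∃ L : Kernel (EuclideanSpace ℝ (Fin m) × EuclideanSpace ℝ (Fin n))
            (EuclideanSpace ℝ (Fin k)),
          IsMarkovKernel L ∧
          HasLaw (fun w => w.2) (multivariateGaussian 0 (Matrix.diagonal d)) (p ⊗ₘ L) ∧
          iIndepFun (fun i w => w.2 i) (p ⊗ₘ L) ∧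
          (∀ i, IndepFun (fun w => σ i * (∑ j, V j i * w.1.1 j) + w.2 i) (fun w => w.2 i)
            (p ⊗ₘ L)) ∧
          L.map Q.toEuclideanLin ∈ admissible p D ∧
          attackedInfo p (L.map Q.toEuclideanLin) =
            ENNReal.ofReal (1 / 2 * ∑ i, Real.log (σ i ^ 2 / d i))) ∧
    (∑ i, σ i ^ 2 ≤ D →
      IsLeast (attackedInfo p '' admissible p D) 0 ∧
      cancelAttack H ∈ admissible p D ∧
      attackedInfo p (cancelAttack H) = 0) := by
  obtain ⟨hUm, hUlaw⟩ := map_eq_stdGaussian hU_law hU_indep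
  obtain rfl : p = sourceLaw H := by
    rw [hp, sourceLaw, ← hUlaw, AEMeasurable.map_map_of_aemeasurable (by fun_prop) hUm]
    rfl
  refine ⟨fun hD hDσ => ?_, fun hD => ?_⟩
  · obtain ⟨τ, hτ, hsum⟩ := exists_waterLevel (fun i => pow_pos (hH.pos i) 2) hD hDσ
    lift τ to ℝ≥0 using hτ.le
    obtain ⟨v, hv⟩ : ∃ v : Fin k → ℝ≥0, ∀ i, (v i : ℝ) = σ i ^ 2 :=
      ⟨fun i => ⟨σ i ^ 2, sq_nonneg _⟩, fun _ => rfl⟩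
    have hτ0 : τ ≠ 0 := fun h => hτ.ne' (by simp [h])
    have hv0 : ∀ i, v i ≠ 0 := fun i h => (pow_pos (hH.pos i) 2).ne' (by rw [← hv i, h]; rfl)
    obtain ⟨d, hd⟩ : ∃ d : Fin k → ℝ≥0, ∀ i, d i = min (v i) τ := ⟨_, fun _ => rfl⟩
    have hdcoe : ∀ i, (d i : ℝ) = min (σ i ^ 2) τ := fun i => by rw [hd, NNReal.coe_min, hv]
    have hd0 : ∀ i, d i ≠ 0 := fun i => by
      rw [hd]
      rcases min_choice (v i) τ with h | h <;> rw [h]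
      exacts [hv0 i, hτ0]
    have hdsum : ∑ i, (d i : ℝ) = D := by simp_rw [hdcoe, hsum]
    -- The variance of `W i` is `v i - d i`; truncated subtraction is exact here because `d i ≤ v
    -- i`.
    have had : ∀ i, (v i - d i) + d i = v i := fun i =>
      tsub_add_cancel_of_le ((hd i).trans_le (min_le_left _ _))
    have hmem := hH.optimal_mem_admissible hv had
    have heq := le_antisymm (hH.attackedInfo_optimal_le hv had hd0)
      (hH.le_attackedInfo hv hτ0 hd hmem)
    have hlower := fun κ hκ => hH.le_attackedInfo (κ := κ) hv hτ0 hd hκ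
    simp only [hdsum, hv] at hmem heq hlower
    refine ⟨τ, hτ, fun i => d i, hdcoe, hdsum, ⟨⟨_, hmem, heq⟩, ?_⟩,
      (reverseLaw H σ V (fun i => v i - d i) d).condKernel, inferInstance, ?_, ?_, ?_, hmem, heq⟩
    · rintro _ ⟨κ, hκ, rfl⟩
      exact hlower κ hκ
    all_goals rw [hH.compProd_condKernel_reverseLaw hv had]
    · exact hasLaw_noise_reverseLaw _ d
    · exact iIndepFun_noise_reverseLaw _ d
    · exact hH.indepFun_reverseLaw _ d
  · have hmem := hH.cancelAttack_mem_admissible hD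
    exact ⟨⟨⟨_, hmem, attackedInfo_cancelAttack⟩, fun _ _ => zero_le⟩, hmem,
      attackedInfo_cancelAttack⟩
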